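/- Let $G$ be a finite loopless digraph and $s\ge 1$ an integer. In the guessing game $(G,s)$ every vertex $v$ is assigned a value $a_v\in A_s=\{0,\dots,s-1\}$, uniformly and independently at random. A strategy $\mathcal F=(f_v)_{v\in V(G)}$ consists of functions $f_v\colon A_s^{\Gamma^-(v)}\to A_s$, where $\Gamma^-(v)=\{u: uv\in E(G)\}$; player $v$ guesses $f_v\big((a_u)_{u\in\Gamma^-(v)}\big)$, and the players win if every $v$ guesses $a_v$. Put $$\mathrm{gn}(G,s)=|V(G)|+\log_s\Big(\max_{\mathcal F}\mathbf P[\text{the players win with }\mathcal F]\Big),\qquad \mathrm{gn}(G)=\lim_{s\to\infty}\mathrm{gn}(G,s).$$ An undirected graph is regarded as the digraph containing both $uv$ and $vu$ for every undirected edge $uv$. Let $R$ be the undirected graph with vertices $1,\dots,10$ and the following $27$ edges: $1$ is joined to each of $2,\dots,7$; the edges $23,34,45,56,67,72$ form a hexagon; $8,9,10$ form a triangle; $8$ is joined to $3,4,6,7$; $9$ is joined to $2,3,5,6$; and $10$ is joined to $2,7,4,5$. Let $R_c$ be obtained from $R$ by cloning the vertices $8,9,10$: add vertices $8',9',10'$,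 and join two of the $13$ vertices exactly when the vertices of $R$ from which they stem are adjacent (so a vertex is not joined to its clone). Let $R_c^-$ be the undirected graph $R_c$ with the undirected edge between $3$ and $8$ removed, and let $R_c^+$ be the digraph $R_c^-$ with the single directed edge from $3$ to $8$ added (so player $8$ sees player $3$, but player $3$ does not see player $8$). **Theorem.** The limits defining $\mathrm{gn}(R_c^-)$ and $\mathrm{gn}(R_c^+)$ exist, and $$\mathrm{gn}(R_c^-)=\frac{53}{6},\qquad \mathrm{gn}(R_c^+)=9.$$ In particular, adding a single directed edge between two non-adjacent vertices of an undirected graph can increase its asymptotic guessing number. -/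

import Mathlib

open Filter Topology

namespace GuessingGame

section Game

variable {V : Type*} [Fintype V]

/-- The in-neighbourhood of `v`: the players whose values player `v` sees. -/
abbrev InNeighbor {V : Type*} (G : Digraph V) (v : V) : Type _ := {u : V // G.Adj u v}

/-- A (pure) strategy for the guessing game `(G, s)`: for every player `v` a function from the
values of the in-neighbours of `v` to the alphabet `Fin s`. -/
abbrev Strategy {V : Type*} (G : Digraph V) (s : ℕ) : Type _ :=
  (v : V) → (InNeighbor G v → Fin s) → Fin s

/-- The event that all players guess their own value correctly. -/
def win {V : Type*} (G : Digraph V) (s : ℕ) (F : Strategy G s) : Set (V → Fin s) :=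
  {a | ∀ v, F v (fun u => a u.1) = a v}

/-- The probability of winning when the values are independent and uniform on `Fin s`, that is,
when the assignment is uniform on `V → Fin s`. -/
noncomputable def winProb (G : Digraph V) (s : ℕ) (F : Strategy G s) : ℝ :=
  ((win G s F).ncard : ℝ) / (s : ℝ) ^ Fintype.card V

/-- The guessing number `gn(G, s) = |V(G)| + log_s (max_F P[Win(G, s, F)])`.  For `s ≥ 1` the
supremum is over a finite nonempty family, hence is a maximum. -/
noncomputable def guessingNumber (G : Digraph V) (s : ℕ) : ℝ :=
  Fintype.card V + Real.logb s (⨆ F : Strategy G s, winProb G s F)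

/-- `G` has asymptotic guessing number `x`: the guessing numbers `gn(G, s)` converge to `x` as the
alphabet size `s` tends to infinity. -/
def HasAsymptoticGuessingNumber (G : Digraph V) (x : ℝ) : Prop :=
  Tendsto (fun s : ℕ => guessingNumber G s) atTop (𝓝 x)

end Game

/-- An undirected graph as a digraph: every undirected edge gives both directed edges. -/
def toDigraph {V : Type*} (G : SimpleGraph V) : Digraph V where
  Adj := G.Adj

/-- Add the single directed edge from `u` to `v`. -/
def addArc {V : Type*} (G : Digraph V) (u v : V) : Digraph V where
  Adj x y := G.Adj x y ∨ (x = u ∧ y = v)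

/-- The ten vertices `1, …, 10` of the graph `R`. -/
inductive RVertex
  | v1 | v2 | v3 | v4 | v5 | v6 | v7 | v8 | v9 | v10
  deriving DecidableEq

open RVertex

instance : Fintype RVertex where
  elems := {v1, v2, v3, v4, v5, v6, v7, v8, v9, v10}
  complete v := by cases v <;> decide

/-- The 27 edges of `R`: the hub `1` is joined to the hexagon `2 3 4 5 6 7`, the vertices
`8, 9, 10` form a triangle, and each of them is joined to the ends of two opposite edges of the
hexagon. -/
def REdges : List (RVertex × RVertex) :=
  [(v1, v2), (v1, v3), (v1, v4), (v1, v5), (v1, v6), (v1, v7),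
   (v2, v3), (v3, v4), (v4, v5), (v5, v6), (v6, v7), (v7, v2),
   (v8, v9), (v8, v10), (v9, v10),
   (v8, v3), (v8, v4), (v8, v6), (v8, v7),
   (v9, v2), (v9, v3), (v9, v5), (v9, v6),
   (v10, v2), (v10, v7), (v10, v4), (v10, v5)]

/-- The undirected graph `R` on ten vertices. -/
def R : SimpleGraph RVertex where
  Adj u v := (u, v) ∈ REdges ∨ (v, u) ∈ REdges
  symm := ⟨fun _ _ h => h.symm⟩
  loopless := ⟨fun v => by cases v <;> simp [REdges]⟩

/-- The vertices `8, 9, 10` of `R`, which are cloned to form `R_c`. -/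
def clonedVertices : Finset RVertex := {v8, v9, v10}

/-- The thirteen vertices of `R_c`: `Sum.inl v` is the original vertex `v` and `Sum.inr v` is the
clone `v'` of a vertex `v` among `8, 9, 10`. -/
abbrev RcVertex : Type := RVertex ⊕ {v : RVertex // v ∈ clonedVertices}

/-- `R_c`: two vertices are adjacent if and only if the vertices of `R` from which they stem are.
In particular a vertex and its clone are not adjacent. -/
def Rc : SimpleGraph RcVertex :=
  R.comap (Sum.elim id Subtype.val)

/-- `R_c^-`: the graph `R_c` without the undirected edge between `3` and `8`. -/
def RcMinus : SimpleGraph RcVertex :=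
  Rc.deleteEdges {s(Sum.inl v3, Sum.inl v8)}

/-- `R_c^+`: the digraph `R_c^-` with the additional directed edge from `3` to `8`. -/
def RcPlus : Digraph RcVertex :=
  addArc (toDigraph RcMinus) (Sum.inl v3) (Sum.inl v8)

end GuessingGame

/-!
A set of assignments on which all players can guess correctly with a common strategy is a code: on
it, every value is a function of the values that its player sees. The winning probability is the
density of a code, so `gn(G, s)` is the largest `log_s` of the size of a code over an alphabet with
`s` letters. Powers of a code over one fixed alphabet, embedded into `Fin s`, turn a single code
into an asymptotic lower bound.

For the upper bounds, the entropies of the values of sets of players for a uniformly random element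
of a code satisfy the Shannon inequalities, and a player adds no entropy to a set containing all
players it sees. Nine of the thirteen players of `R_c^+` determine the others, and nine instances of
submodularity combine with bounds on the entropies of smaller sets to `6 gn(R_c^-, s) ≤ 53`.

For the lower bounds, a digraph has a linear code of codimension at most `r` as soon as a matrix of
rank `r` has nonzero diagonal entries and no other nonzero entry outside its arcs; `R_c^+` has such
a ternary matrix of rank `4`, and a triangle one of rank `1`. Splitting each letter into six
symbols, every vertex of `R_c^-` is covered six times by three copies of `R_c^+`, in each of which
both `8` and its clone are placed on the clone, and thirteen triangles. This gives
`(3 * 9 + 13 * 2) / 6 = 53 / 6`.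
-/

namespace GuessingGame

section Entropy

open Finset Real
open scoped BigOperators

variable {Ω : Type*} [Fintype Ω]

open Classical in
/-- The class of `a` under the equivalence relation `r`, as a finite set. -/
noncomputable def cell (r : Setoid Ω) (a : Ω) : Finset Ω := {b | r b a}

/-- The Shannon entropy of the class under `r` of a uniformly random element of `Ω`. A random
variable `f` on `Ω` is represented by `Setoid.ker f`, so that the join of two random variables
is `⊓`. -/
noncomputable def entropy (r : Setoid Ω) : ℝ := 𝔼 a, log (Fintype.card Ω / #(cell r a))

@[simp]
lemma mem_cell {r : Setoid Ω} {a b : Ω} : b ∈ cell r a ↔ r b a := by simp [cell]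

lemma card_cell_pos (r : Setoid Ω) (a : Ω) : 0 < #(cell r a) :=
  card_pos.mpr ⟨a, mem_cell.mpr (r.refl a)⟩

lemma cell_mono {r s : Setoid Ω} (h : r ≤ s) (a : Ω) : cell r a ⊆ cell s a :=
  fun _ hb => mem_cell.mpr (h (mem_cell.mp hb))

lemma cell_eq_of_rel {r : Setoid Ω} {a b : Ω} (h : r a b) : cell r a = cell r b := by
  ext c
  simpa using ⟨fun hc => r.trans hc h, fun hc => r.trans hc (r.symm h)⟩

lemma sum_inv_card_cell_le_one {r : Setoid Ω} {S : Finset Ω} (hS : ∀ a ∈ S, ∀ b ∈ S, r b a) :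
    ∑ a ∈ S, (#(cell r a) : ℝ)⁻¹ ≤ 1 := by
  rcases S.eq_empty_or_nonempty with rfl | hne
  · simp
  have hpos : (0 : ℝ) < #S := by exact_mod_cast hne.card_pos
  calc ∑ a ∈ S, (#(cell r a) : ℝ)⁻¹
      ≤ ∑ _a ∈ S, (#S : ℝ)⁻¹ := by
        gcongr with a ha
        exact fun b hb => mem_cell.mpr (hS a ha b hb)
    _ = 1 := by rw [sum_const, nsmul_eq_mul, mul_inv_cancel₀ hpos.ne']

lemma sum_card_cell_div_card_cell_inf_le {r s t : Setoid Ω} (hr : r ≤ t) (hs : s ≤ t) (b : Ω) :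
    ∑ a ∈ cell r b, (#(cell s a) : ℝ) / #(cell (r ⊓ s) a) ≤ #(cell t b) := by
  classical
  calc ∑ a ∈ cell r b, (#(cell s a) : ℝ) / #(cell (r ⊓ s) a)
      = ∑ a ∈ cell r b, ∑ _c ∈ cell s a, (#(cell (r ⊓ s) a) : ℝ)⁻¹ := by
        simp only [sum_const, nsmul_eq_mul, div_eq_mul_inv]
    _ = ∑ c ∈ cell t b, ∑ a ∈ cell r b ∩ cell s c, (#(cell (r ⊓ s) a) : ℝ)⁻¹ := by
        refine sum_comm' fun a c => ?_
        simp only [mem_inter, mem_cell]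
        exact ⟨fun h => ⟨⟨h.1, s.symm h.2⟩, t.trans (hs h.2) (hr h.1)⟩,
          fun h => ⟨h.1.1, s.symm h.1.2⟩⟩
    _ ≤ ∑ _c ∈ cell t b, 1 := by
        gcongr with c
        refine sum_inv_card_cell_le_one fun a ha d hd => ?_
        simp only [mem_inter, mem_cell] at ha hd
        exact ⟨r.trans hd.1 (r.symm ha.1), s.trans hd.2 (s.symm ha.2)⟩
    _ = #(cell t b) := by simp

lemma sum_card_cell_mul_card_cell_div_le {r s t : Setoid Ω} (hr : r ≤ t) (hs : s ≤ t) :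
    ∑ a, (#(cell r a) * #(cell s a) : ℝ) / (#(cell (r ⊓ s) a) * #(cell t a)) ≤
      Fintype.card Ω := by
  calc ∑ a, (#(cell r a) * #(cell s a) : ℝ) / (#(cell (r ⊓ s) a) * #(cell t a))
      = ∑ a, ∑ _b ∈ cell r a, (#(cell s a) / #(cell (r ⊓ s) a) / #(cell t a) : ℝ) := by
        simp only [sum_const, nsmul_eq_mul, div_div, mul_div_assoc]
    _ = ∑ b, ∑ a ∈ cell r b, (#(cell s a) / #(cell (r ⊓ s) a) / #(cell t a) : ℝ) :=
        sum_comm' fun a b => by simp [r.comm']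
    _ = ∑ b, (∑ a ∈ cell r b, (#(cell s a) / #(cell (r ⊓ s) a) : ℝ)) / #(cell t b) := by
        simp only [sum_div]
        refine sum_congr rfl fun b _ => sum_congr rfl fun a ha => ?_
        rw [cell_eq_of_rel (hr (mem_cell.mp ha))]
    _ ≤ ∑ _b : Ω, 1 := by
        gcongr with b
        exact div_le_one_of_le₀ (sum_card_cell_div_card_cell_inf_le hr hs b) (Nat.cast_nonneg _)
    _ = Fintype.card Ω := by simp

lemma expect_log_nonpos {x : Ω → ℝ} (hx : ∀ a, 0 < x a) (hsum : ∑ a, x a ≤ Fintype.card Ω) :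
    𝔼 a, log (x a) ≤ 0 := by
  have hlog : ∑ a, log (x a) ≤ ∑ a, (x a - 1) :=
    sum_le_sum fun a _ => log_le_sub_one_of_pos (hx a)
  rw [sum_sub_distrib, sum_const, card_univ, nsmul_one] at hlog
  rw [Fintype.expect_eq_sum_div_card]
  exact div_nonpos_of_nonpos_of_nonneg (by linarith) (Nat.cast_nonneg _)

theorem entropy_inf_add_entropy_le {r s t : Setoid Ω} (hr : r ≤ t) (hs : s ≤ t) :
    entropy (r ⊓ s) + entropy t ≤ entropy r + entropy s := by
  have hpos (q : Setoid Ω) (a : Ω) : (0 : ℝ) < #(cell q a) := by exact_mod_cast card_cell_pos q a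
  rw [← sub_nonpos]
  calc entropy (r ⊓ s) + entropy t - (entropy r + entropy s)
      = 𝔼 a, log ((#(cell r a) * #(cell s a)) / (#(cell (r ⊓ s) a) * #(cell t a))) := by
        simp only [entropy, ← expect_add_distrib, ← expect_sub_distrib]
        refine expect_congr rfl fun a _ => ?_
        have : Nonempty Ω := ⟨a⟩
        have hΩ : (Fintype.card Ω : ℝ) ≠ 0 := by exact_mod_cast Fintype.card_ne_zero
        simp only [log_div, log_mul, mul_ne_zero, hΩ, (hpos _ a).ne', ne_eq, not_false_eq_true]
        ring
    _ ≤ 0 := expect_log_nonpos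
        (fun a => div_pos (mul_pos (hpos _ a) (hpos _ a)) (mul_pos (hpos _ a) (hpos _ a)))
        (sum_card_cell_mul_card_cell_div_le hr hs)

lemma entropy_anti {r s : Setoid Ω} (h : r ≤ s) : entropy s ≤ entropy r := by
  refine expect_le_expect fun a _ => ?_
  have hr : (0 : ℝ) < #(cell r a) := by exact_mod_cast card_cell_pos r a
  have hs : (0 : ℝ) < #(cell s a) := by exact_mod_cast card_cell_pos s a
  have hΩ : (0 : ℝ) < Fintype.card Ω := by exact_mod_cast Fintype.card_pos_iff.mpr ⟨a⟩
  gcongr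
  exact cell_mono h a

@[simp]
lemma entropy_top : entropy (⊤ : Setoid Ω) = 0 := by
  refine expect_eq_zero fun a _ => ?_
  have hcell : cell ⊤ a = (univ : Finset Ω) := by ext; simp
  have : Nonempty Ω := ⟨a⟩
  rw [hcell, card_univ, div_self (by exact_mod_cast Fintype.card_ne_zero), log_one]

@[simp]
lemma entropy_bot : entropy (⊥ : Setoid Ω) = log (Fintype.card Ω) := by
  have hcell (a : Ω) : cell ⊥ a = {a} := by ext; simp
  rcases isEmpty_or_nonempty Ω with hΩ | hΩ
  · simp [entropy]
  · simp [entropy, hcell]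

lemma sum_inv_card_cell_ker_le {β : Type*} [Fintype β] (f : Ω → β) :
    ∑ a, (#(cell (.ker f) a) : ℝ)⁻¹ ≤ Fintype.card β := by
  classical
  calc ∑ a, (#(cell (.ker f) a) : ℝ)⁻¹
      = ∑ b, ∑ a with f a = b, (#(cell (.ker f) a) : ℝ)⁻¹ := (sum_fiberwise _ _ _).symm
    _ ≤ ∑ _b : β, 1 := by
      gcongr with b
      refine sum_inv_card_cell_le_one fun a ha d hd => ?_
      simp only [mem_filter, mem_univ, true_and] at ha hd
      exact hd.trans ha.symm
    _ = Fintype.card β := by simp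

theorem entropy_ker_le {β : Type*} [Fintype β] (f : Ω → β) :
    entropy (Setoid.ker f) ≤ log (Fintype.card β) := by
  rcases isEmpty_or_nonempty Ω with hΩ | hΩ
  · simpa [entropy] using log_natCast_nonneg _
  have : Nonempty β := hΩ.map f
  have hΩpos : (0 : ℝ) < Fintype.card Ω := by exact_mod_cast Fintype.card_pos
  have hβpos : (0 : ℝ) < Fintype.card β := by exact_mod_cast Fintype.card_pos
  have hpos (a : Ω) : (0 : ℝ) < #(cell (.ker f) a) := by exact_mod_cast card_cell_pos _ a
  rw [← sub_nonpos]
  calc entropy (.ker f) - log (Fintype.card β)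
      = 𝔼 a, log (Fintype.card Ω / Fintype.card β * (#(cell (.ker f) a) : ℝ)⁻¹) := by
        rw [entropy, ← Fintype.expect_const (ι := Ω) (log (Fintype.card β)), ← expect_sub_distrib]
        refine expect_congr rfl fun a _ => ?_
        rw [← log_div (div_pos hΩpos (hpos a)).ne' hβpos.ne', ← div_eq_mul_inv, div_right_comm]
    _ ≤ 0 := by
        refine expect_log_nonpos (fun a => mul_pos (div_pos hΩpos hβpos) (inv_pos.mpr (hpos a))) ?_
        rw [← mul_sum]
        calc (Fintype.card Ω / Fintype.card β * ∑ a, (#(cell (.ker f) a) : ℝ)⁻¹ : ℝ)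
            ≤ Fintype.card Ω / Fintype.card β * Fintype.card β := by
              gcongr
              exact sum_inv_card_cell_ker_le f
          _ = Fintype.card Ω := div_mul_cancel₀ _ hβpos.ne'

end Entropy

section Codes

variable {V A B : Type*} {G : Digraph V}

/-- A set of assignments on which the value of every player is a function of the values that the
player sees. For the alphabet `Fin s`, the nonempty codes are the nonempty sets of assignments on
which all players guess correctly with a common strategy. -/
def IsCode (G : Digraph V) (W : Set (V → A)) : Prop :=
  ∀ a ∈ W, ∀ b ∈ W, ∀ v, (∀ u, G.Adj u v → a u = b u) → a v = b v

lemma IsCode.image {W : Set (V → A)} (hW : IsCode G W) {f : A → B} (hf : f.Injective) :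
    IsCode G ((f ∘ ·) '' W) := by
  rintro _ ⟨a, ha, rfl⟩ _ ⟨b, hb, rfl⟩ v h
  exact congrArg f (hW a ha b hb v fun u hu => hf (h u hu))

lemma isCode_win {s : ℕ} (F : Strategy G s) : IsCode G (win G s F) := by
  intro a ha b hb v h
  rw [← ha v, ← hb v, funext fun u : InNeighbor G v => h u.1 u.2]

lemma IsCode.exists_subset_win {s : ℕ} {W : Set (V → Fin s)} (hW : IsCode G W)
    (hne : W.Nonempty) : ∃ F : Strategy G s, W ⊆ win G s F := by
  obtain ⟨a₀, -⟩ := hne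
  let view (v : V) (a : W) (u : InNeighbor G v) : Fin s := a.1 u.1
  have hview (v : V) : Function.FactorsThrough (fun a : W => a.1 v) (view v) := fun a b hab =>
    hW a a.2 b b.2 v fun u hu => congrFun hab ⟨u, hu⟩
  exact ⟨fun v => Function.extend (view v) (fun a => a.1 v) fun _ => a₀ v,
    fun a ha v => (hview v).extend_apply _ ⟨a, ha⟩⟩

variable [Fintype V]

theorem isGreatest_guessingNumber (G : Digraph V) {s : ℕ} (hs : 2 ≤ s) :
    IsGreatest {x | ∃ W : Set (V → Fin s), W.Nonempty ∧ IsCode G W ∧ Real.logb s W.ncard = x}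
      (guessingNumber G s) := by
  have : NeZero s := ⟨by omega⟩
  have hs1 : (1 : ℝ) < s := by exact_mod_cast hs
  have hpow : (0 : ℝ) < (s : ℝ) ^ Fintype.card V := by positivity
  obtain ⟨F₀, hF₀⟩ := exists_eq_ciSup_of_finite (f := winProb G s)
  have hmax (F : Strategy G s) : (win G s F).ncard ≤ (win G s F₀).ncard := by
    have : winProb G s F ≤ winProb G s F₀ := hF₀ ▸ le_ciSup (Set.finite_range _).bddAbove F
    exact_mod_cast (div_le_div_iff_of_pos_right hpow).mp this
  have hne : (win G s F₀).Nonempty := by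
    have hzero : (win G s fun _ _ => 0).Nonempty := ⟨0, fun _ => rfl⟩
    exact (Set.ncard_pos).mp (((Set.ncard_pos).mpr hzero).trans_le (hmax _))
  have hgn : guessingNumber G s = Real.logb s (win G s F₀).ncard := by
    have hcard : ((win G s F₀).ncard : ℝ) ≠ 0 := by exact_mod_cast ((Set.ncard_pos).mpr hne).ne'
    rw [guessingNumber, ← hF₀, winProb, Real.logb_div hcard hpow.ne', Real.logb_pow,
      Real.logb_self_eq_one hs1, mul_one, add_sub_cancel]
  refine ⟨⟨_, hne, isCode_win F₀, hgn.symm⟩, ?_⟩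
  rintro _ ⟨W, hWne, hW, rfl⟩
  obtain ⟨F, hF⟩ := hW.exists_subset_win hWne
  rw [hgn]
  refine Real.logb_le_logb_of_le hs1 (by exact_mod_cast (Set.ncard_pos).mpr hWne) ?_
  exact_mod_cast (Set.ncard_le_ncard hF).trans (hmax F)

lemma guessingNumber_le {s : ℕ} (hs : 2 ≤ s) {x : ℝ}
    (h : ∀ W : Set (V → Fin s), W.Nonempty → IsCode G W →
      Real.log W.ncard ≤ x * Real.log s) : guessingNumber G s ≤ x := by
  obtain ⟨W, hne, hW, hlog⟩ := (isGreatest_guessingNumber G hs).1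
  rw [← hlog, Real.logb, div_le_iff₀ (Real.log_pos (by exact_mod_cast hs))]
  exact h W hne hW

lemma IsCode.logb_ncard_le_guessingNumber [Finite A] {W : Set (V → A)} (hW : IsCode G W)
    (hne : W.Nonempty) {s : ℕ} (hs : 2 ≤ s) (hA : Nat.card A ≤ s) :
    Real.logb s W.ncard ≤ guessingNumber G s := by
  have := Fintype.ofFinite A
  obtain ⟨f⟩ : Nonempty (A ↪ Fin s) :=
    Function.Embedding.nonempty_of_card_le (by simpa [Nat.card_eq_fintype_card] using hA)
  refine (isGreatest_guessingNumber G hs).2 ⟨_, hne.image _, hW.image f.injective, ?_⟩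
  rw [Set.ncard_image_of_injective _ f.injective.comp_left]

end Codes

section Covers

variable {ι V A : Type*} {U : ι → Type*}

lemma ncard_univ_pi [Fintype ι] {α : ι → Type*} (W : ∀ i, Set (α i)) :
    (Set.univ.pi W).ncard = ∏ i, (W i).ncard := by
  rw [← Nat.card_coe_set_eq, Nat.card_congr (Equiv.Set.univPi W), Nat.card_pi]
  simp only [Nat.card_coe_set_eq]

lemma exists_equiv_of_card_fiber [Fintype ι] [∀ i, Finite (U i)] {f : ∀ i, U i → V} {k : ℕ}
    (hf : ∀ v, ∑ i, Nat.card {u // f i u = v} = k) :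
    ∃ e : (Σ i, U i) ≃ V × Fin k, ∀ i u, (e ⟨i, u⟩).1 = f i u := by
  let π (p : Σ i, U i) : V := f p.1 p.2
  have hfiber (v : V) : Nat.card {p // π p = v} = k := by
    rw [← hf v, ← Nat.card_sigma]
    exact Nat.card_congr
      ⟨fun p => ⟨p.1.1, p.1.2, p.2⟩, fun q => ⟨⟨q.1, q.2.1⟩, q.2.2⟩, fun _ => rfl, fun _ => rfl⟩
  exact ⟨(Equiv.sigmaFiberEquiv π).symm.trans ((Equiv.sigmaCongrRight fun v =>
    Finite.equivFinOfCardEq (hfiber v)).trans (.sigmaEquivProd _ _)), fun _ _ => rfl⟩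

theorem exists_isCode_of_cover [Fintype ι] [∀ i, Finite (U i)] {G : Digraph V}
    {H : ∀ i, Digraph (U i)} {W : ∀ i, Set (U i → A)} (hW : ∀ i, IsCode (H i) (W i))
    (f : ∀ i, U i → V) (hadj : ∀ i u w, (H i).Adj u w → G.Adj (f i u) (f i w)) {k : ℕ}
    (hf : ∀ v, ∑ i, Nat.card {u // f i u = v} = k) :
    ∃ W' : Set (V → Fin k → A), IsCode G W' ∧ W'.ncard = ∏ i, (W i).ncard := by
  obtain ⟨e, he⟩ := exists_equiv_of_card_fiber hf
  let E : (V → Fin k → A) ≃ ∀ i, U i → A := (Equiv.curry V (Fin k) A).symm.trans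
    ((e.symm.arrowCongr (.refl A)).trans (.piCurry fun _ _ => A))
  have hE (a : V → Fin k → A) (i : ι) (u : U i) : E a i u = a (e ⟨i, u⟩).1 (e ⟨i, u⟩).2 := rfl
  refine ⟨E ⁻¹' Set.univ.pi W, fun a ha b hb v hab => ?_, ?_⟩
  · ext j
    obtain ⟨⟨i, w⟩, hw⟩ := e.surjective (v, j)
    have hfw : f i w = v := by rw [← he, hw]
    have := hW i _ (ha i trivial) _ (hb i trivial) w fun u hu => by
      rw [hE, hE, hab _ (hfw ▸ he i u ▸ hadj i u w hu)]
    simpa only [hE, hw] using this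
  · rw [← ncard_univ_pi, ← Set.ncard_image_of_injective _ E.injective,
      Set.image_preimage_eq _ E.surjective]

lemma IsCode.exists_pow [Finite V] {G : Digraph V} {W : Set (V → A)} (hW : IsCode G W) (j : ℕ) :
    ∃ W' : Set (V → Fin j → A), IsCode G W' ∧ W'.ncard = W.ncard ^ j := by
  simpa using exists_isCode_of_cover (fun _ : Fin j => hW) (fun _ => id) (fun _ _ _ h => h)
    (k := j) (by simp)

end Covers

section Limit

open Real

lemma tendsto_natLog_div_logb {q : ℕ} (hq : 1 < q) :
    Tendsto (fun s : ℕ => (Nat.log q s : ℝ) / logb q s) atTop (𝓝 1) := by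
  have hlogb : Tendsto (fun s : ℕ => logb q s) atTop atTop :=
    (tendsto_logb_atTop (by exact_mod_cast hq)).comp tendsto_natCast_atTop_atTop
  simpa [Function.comp_def, natFloor_logb_natCast] using
    (tendsto_nat_floor_div_atTop (R := ℝ)).comp hlogb

theorem IsCode.hasAsymptoticGuessingNumber {V A : Type*} [Fintype V] [Finite A] [Nontrivial A]
    {G : Digraph V} {W : Set (V → A)} (hW : IsCode G W) (hne : W.Nonempty) {x : ℝ}
    (hx : x * log (Nat.card A) ≤ log W.ncard) (hle : ∀ s, 2 ≤ s → guessingNumber G s ≤ x) :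
    HasAsymptoticGuessingNumber G x := by
  have hA : 1 < Nat.card A := Finite.one_lt_card
  have hlim := (tendsto_natLog_div_logb hA).const_mul x
  rw [mul_one] at hlim
  refine tendsto_of_tendsto_of_tendsto_of_le_of_le' hlim tendsto_const_nhds ?_
    (eventually_atTop.mpr ⟨2, hle⟩)
  filter_upwards [eventually_ge_atTop 2] with s hs
  set j := Nat.log (Nat.card A) s
  obtain ⟨W', hW', hcard⟩ := hW.exists_pow j
  have hne' : W'.Nonempty := Set.nonempty_of_ncard_ne_zero
    (by rw [hcard]; exact pow_ne_zero j ((Set.ncard_pos).mpr hne).ne')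
  calc x * (j / logb (Nat.card A) s)
      = j * (x * log (Nat.card A)) / log s := by rw [logb, div_div_eq_mul_div]; ring
    _ ≤ j * log W.ncard / log s := by gcongr
    _ = logb s W'.ncard := by rw [hcard, Nat.cast_pow, logb_pow, logb, mul_div_assoc]
    _ ≤ guessingNumber G s := by
        refine hW'.logb_ncard_le_guessingNumber hne' hs ?_
        simpa [Nat.card_fun] using Nat.pow_log_le_self (Nat.card A) (by omega)

end Limit

section Polymatroid

variable {V A : Type*} {G : Digraph V}

/-- On every code for `G`, the values of the players in `S` determine the value of `v` for the
immediate reason that `v` belongs to `S` or sees only players in `S`. -/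
def Determines (G : Digraph V) (S : Finset V) (v : V) : Prop :=
  v ∈ S ∨ ∀ u, G.Adj u v → u ∈ S

instance [Fintype V] [DecidableEq V] (G : Digraph V) [DecidableRel G.Adj] (S : Finset V) (v : V) :
    Decidable (Determines G S v) :=
  inferInstanceAs (Decidable (v ∈ S ∨ ∀ u, G.Adj u v → u ∈ S))

/-- The equivalence relation on `W` standing for the joint value of the players in `S`, as a random
variable. -/
def agreeOn (W : Set (V → A)) (S : Finset V) : Setoid W := .ker fun a (v : S) => a.1 v

lemma agreeOn_iff {W : Set (V → A)} {S : Finset V} {a b : W} :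
    agreeOn W S a b ↔ ∀ v ∈ S, a.1 v = b.1 v :=
  ⟨fun h v hv => congrFun h ⟨v, hv⟩, fun h => funext fun v => h v v.2⟩

variable [DecidableEq V]

/-- The Shannon inequalities satisfied by the entropies `h S` of the values of the players in `S` on
a code for `G`, the entropy of a single value being at most `c`. The field `submodular` combines
submodularity with `h X = h (T ∪ U)` where `X ⊇ T ∪ U` only adds players determined by `T ∪ U`. -/
structure IsGuessingPolymatroid (G : Digraph V) (c : ℝ) (h : Finset V → ℝ) : Prop where
  empty : h ∅ = 0
  singleton_le (v : V) : h {v} ≤ c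
  submodular {T U X Y : Finset V} (hX : ∀ v ∈ X, Determines G (T ∪ U) v) (hY : Y ⊆ T ∩ U) :
    h X + h Y ≤ h T + h U

namespace IsGuessingPolymatroid

variable {c : ℝ} {h : Finset V → ℝ}

lemma le_of_determines (H : IsGuessingPolymatroid G c h) {S X : Finset V}
    (hX : ∀ v ∈ X, Determines G S v) : h X ≤ h S := by
  have := H.submodular (T := S) (U := S) (X := X) (Y := S) (by simpa using hX) (by simp)
  linarith

lemma union_le (H : IsGuessingPolymatroid G c h) (Y S : Finset V) :
    h (Y ∪ S) ≤ h Y + S.card * c := by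
  induction S using Finset.induction_on with
  | empty => simp
  | insert a S ha ih =>
    have hsub : h (Y ∪ insert a S) + h ∅ ≤ h (Y ∪ S) + h {a} := by
      refine H.submodular (fun v hv => .inl ?_) (Finset.empty_subset _)
      rwa [Finset.union_assoc, Finset.union_comm S, ← Finset.insert_eq]
    have := H.singleton_le a
    rw [H.empty] at hsub
    rw [Finset.card_insert_of_notMem ha]
    push_cast
    linarith

lemma le_add_card_mul (H : IsGuessingPolymatroid G c h) {X : Finset V} (Y S : Finset V)
    (hX : ∀ v ∈ X, Determines G (Y ∪ S) v) : h X ≤ h Y + S.card * c :=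
  (H.le_of_determines hX).trans (H.union_le Y S)

lemma le_card_mul (H : IsGuessingPolymatroid G c h) {X : Finset V} (S : Finset V)
    (hX : ∀ v ∈ X, Determines G S v) : h X ≤ S.card * c := by
  have := H.le_add_card_mul ∅ S (X := X) (by simpa using hX)
  rwa [H.empty, zero_add] at this

end IsGuessingPolymatroid

theorem IsCode.isGuessingPolymatroid [Fintype A] {W : Set (V → A)} [Fintype W] (hW : IsCode G W) :
    IsGuessingPolymatroid G (Real.log (Fintype.card A)) fun S => entropy (agreeOn W S) where
  empty := by
    have : agreeOn W ∅ = ⊤ := by ext a b; simp [agreeOn_iff]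
    rw [this, entropy_top]
  singleton_le v := by
    simpa [agreeOn] using entropy_ker_le fun (a : W) (u : ({v} : Finset V)) => a.1 u
  submodular {T U X Y} hX hY := by
    have hle : agreeOn W T ⊓ agreeOn W U ≤ agreeOn W X := fun {a b} hab => by
      have hTU : ∀ v ∈ T ∪ U, a.1 v = b.1 v := fun v hv => (Finset.mem_union.mp hv).elim
        (agreeOn_iff.mp hab.1 v) (agreeOn_iff.mp hab.2 v)
      exact agreeOn_iff.mpr fun v hv => (hX v hv).elim (hTU v) fun h =>
        hW a a.2 b b.2 v fun u hu => hTU u (h u hu)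
    have hT : agreeOn W T ≤ agreeOn W Y := fun {a b} h =>
      agreeOn_iff.mpr fun v hv => agreeOn_iff.mp h v (Finset.mem_inter.mp (hY hv)).1
    have hU : agreeOn W U ≤ agreeOn W Y := fun {a b} h =>
      agreeOn_iff.mpr fun v hv => agreeOn_iff.mp h v (Finset.mem_inter.mp (hY hv)).2
    exact (add_le_add_left (entropy_anti hle) _).trans (entropy_inf_add_entropy_le hT hU)

theorem guessingNumber_le_of_polymatroid [Fintype V] {x : ℝ}
    (hx : ∀ (c : ℝ) (h : Finset V → ℝ), IsGuessingPolymatroid G c h → h .univ ≤ x * c) {s : ℕ}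
    (hs : 2 ≤ s) : guessingNumber G s ≤ x := by
  classical
  refine guessingNumber_le hs fun W _ hW => ?_
  have huniv : agreeOn W .univ = ⊥ := by
    ext a b
    simp [agreeOn_iff, ← funext_iff, Subtype.ext_iff]
  have hlog := hx _ _ hW.isGuessingPolymatroid
  rwa [huniv, entropy_bot, ← Nat.card_eq_fintype_card, Nat.card_coe_set_eq, Fintype.card_fin]
    at hlog

end Polymatroid

section Fitting

open Matrix

variable {V m F : Type*} [Fintype m] [Field F] {G : Digraph V}

/-- The matrix with rows `v`, columns `u` and entries `c v ⬝ᵥ b u` fits the digraph `G`: its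
diagonal entries are nonzero, and its other entries vanish unless player `v` sees player `u`. The
least possible size of `m` is Haemers' minimum rank. -/
def Fits (G : Digraph V) (c b : V → m → F) : Prop :=
  ∀ v, c v ⬝ᵥ b v ≠ 0 ∧ ∀ u, c v ⬝ᵥ b u ≠ 0 → u = v ∨ G.Adj u v

instance [Fintype V] [DecidableEq V] [DecidableRel G.Adj] [DecidableEq F] (c b : V → m → F) :
    Decidable (Fits G c b) :=
  inferInstanceAs (Decidable (∀ v, c v ⬝ᵥ b v ≠ 0 ∧ ∀ u, c v ⬝ᵥ b u ≠ 0 → u = v ∨ G.Adj u v))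

variable [Fintype V]

lemma Fits.isCode_ker {c b : V → m → F} (h : Fits G c b) :
    IsCode G (LinearMap.ker (Fintype.linearCombination F b) : Set (V → F)) := by
  intro x hx y hy v hxy
  have hker : Fintype.linearCombination F b (x - y) = 0 :=
    LinearMap.mem_ker.mp (sub_mem hx hy)
  have hsingle : ∑ u, (x - y) u * (c v ⬝ᵥ b u) = (x - y) v * (c v ⬝ᵥ b v) := by
    refine Finset.sum_eq_single_of_mem v (Finset.mem_univ v) fun u _ huv => ?_
    by_cases hcb : c v ⬝ᵥ b u = 0
    · rw [hcb, mul_zero]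
    · rw [Pi.sub_apply, hxy u (((h v).2 u hcb).resolve_left huv), sub_self, zero_mul]
  have hzero : (x - y) v * (c v ⬝ᵥ b v) = 0 := by
    calc (x - y) v * (c v ⬝ᵥ b v)
        = c v ⬝ᵥ Fintype.linearCombination F b (x - y) := by
          simp only [← hsingle, Fintype.linearCombination_apply, dotProduct_sum, dotProduct_smul,
            smul_eq_mul]
      _ = 0 := by rw [hker, dotProduct_zero]
  exact sub_eq_zero.mp ((mul_eq_zero.mp hzero).resolve_right (h v).1)

lemma pow_le_ncard_ker_linearCombination [Finite F] (b : V → m → F) :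
    Nat.card F ^ (Fintype.card V - Fintype.card m) ≤
      (LinearMap.ker (Fintype.linearCombination F b) : Set (V → F)).ncard := by
  have hrank := LinearMap.finrank_range_add_finrank_ker (Fintype.linearCombination F b)
  have hrange := Submodule.finrank_le (LinearMap.range (Fintype.linearCombination F b))
  rw [Module.finrank_fintype_fun_eq_card] at hrank hrange
  calc Nat.card F ^ (Fintype.card V - Fintype.card m)
      ≤ Nat.card F ^ Module.finrank F (LinearMap.ker (Fintype.linearCombination F b)) :=
        Nat.pow_le_pow_right Nat.card_pos (by omega)
    _ = _ := by rw [← Module.natCard_eq_pow_finrank, ← Nat.card_coe_set_eq, SetLike.coe_sort_coe]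

theorem Fits.exists_isCode [Finite F] {c b : V → m → F} (h : Fits G c b) :
    ∃ W : Set (V → F), IsCode G W ∧
      Nat.card F ^ (Fintype.card V - Fintype.card m) ≤ W.ncard :=
  ⟨_, h.isCode_ker, pow_le_ncard_ker_linearCombination b⟩

lemma exists_isCode_top (V F : Type*) [Fintype V] [Field F] [Finite F] :
    ∃ W : Set (V → F), IsCode (toDigraph (⊤ : SimpleGraph V)) W ∧
      Nat.card F ^ (Fintype.card V - 1) ≤ W.ncard := by
  have hfits : Fits (toDigraph (⊤ : SimpleGraph V)) (1 : V → Unit → F) 1 := by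
    simp [Fits, toDigraph, em]
  exact hfits.exists_isCode

end Fitting

instance : DecidableRel R.Adj := fun u v =>
  inferInstanceAs (Decidable ((u, v) ∈ REdges ∨ (v, u) ∈ REdges))

instance : DecidableRel Rc.Adj := fun u v =>
  inferInstanceAs (Decidable (R.Adj (Sum.elim id Subtype.val u) (Sum.elim id Subtype.val v)))

instance : DecidableRel RcMinus.Adj := fun u v =>
  decidable_of_iff (Rc.Adj u v ∧ s(u, v) ≠ s(Sum.inl .v3, Sum.inl .v8)) <| by
    simp [RcMinus, SimpleGraph.deleteEdges_adj]

instance {V : Type*} (G : SimpleGraph V) [DecidableRel G.Adj] : DecidableRel (toDigraph G).Adj :=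
  inferInstanceAs (DecidableRel G.Adj)

instance {V : Type*} [DecidableEq V] (G : Digraph V) [DecidableRel G.Adj] (u v : V) :
    DecidableRel (addArc G u v).Adj := fun x y =>
  inferInstanceAs (Decidable (G.Adj x y ∨ (x = u ∧ y = v)))

instance : DecidableRel RcPlus.Adj :=
  inferInstanceAs (DecidableRel (addArc (toDigraph RcMinus) (Sum.inl .v3) (Sum.inl .v8)).Adj)

namespace RcVertex

abbrev v1 : RcVertex := .inl .v1
abbrev v2 : RcVertex := .inl .v2
abbrev v3 : RcVertex := .inl .v3
abbrev v4 : RcVertex := .inl .v4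
abbrev v5 : RcVertex := .inl .v5
abbrev v6 : RcVertex := .inl .v6
abbrev v7 : RcVertex := .inl .v7
abbrev v8 : RcVertex := .inl .v8
abbrev v9 : RcVertex := .inl .v9
abbrev v10 : RcVertex := .inl .v10
abbrev v8' : RcVertex := .inr ⟨.v8, by decide⟩
abbrev v9' : RcVertex := .inr ⟨.v9, by decide⟩
abbrev v10' : RcVertex := .inr ⟨.v10, by decide⟩

end RcVertex

section UpperBounds

open RcVertex

namespace IsGuessingPolymatroid

variable {c : ℝ} {h : Finset RcVertex → ℝ}

lemma six_mul_univ_add_le (H : IsGuessingPolymatroid (toDigraph RcMinus) c h) :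
    6 * h .univ + (h {v1, v3, v4, v5} + h {v1, v5, v6, v7} + h {v1, v4, v5, v8} +
      h {v1, v5, v6, v10} + h {v1, v4, v5, v6, v9, v9'} +
      h {v1, v4, v5, v6, v8, v10, v8', v10'}) ≤
    2 * h {v1, v2, v3, v4, v5, v6, v7} + h {v1, v3, v4, v5, v8, v10, v8', v10'} +
      h {v1, v5, v6, v7, v8, v9, v8', v9'} + 2 * h {v1, v4, v5, v6, v9, v10, v9', v10'} +
      h {v1, v3, v4, v5, v8} + h {v1, v5, v6, v7, v10} +
      h {v1, v4, v5, v6, v7, v8, v9, v8', v9'} + h {v1, v2, v3, v4, v5, v6, v9, v8', v9'} +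
      h {v1, v3, v4, v5, v6, v8, v10, v8', v10'} +
      h {v1, v2, v4, v5, v6, v7, v8, v10, v8', v10'} := by
  have : h .univ + h {v1, v3, v4, v5} ≤
      h {v1, v2, v3, v4, v5, v6} + h {v1, v3, v4, v5, v8, v10, v8', v10'} :=
    H.submodular (by decide) (by decide)
  have : h .univ + h {v1, v5, v6, v7} ≤
      h {v1, v2, v4, v5, v6, v7} + h {v1, v5, v6, v7, v8, v9, v8', v9'} :=
    H.submodular (by decide) (by decide)
  have : h {v1, v2, v3, v4, v5, v6, v7, v9, v8', v9'} + h {v1, v2, v3, v4, v5, v6} ≤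
      h {v1, v2, v3, v4, v5, v6, v7} + h {v1, v2, v3, v4, v5, v6, v9, v8', v9'} :=
    H.submodular (by decide) (by decide)
  have : h .univ + h {v1, v2, v4, v5, v6, v7} ≤
      h {v1, v2, v3, v4, v5, v6, v7} + h {v1, v2, v4, v5, v6, v7, v8, v10, v8', v10'} :=
    H.submodular (by decide) (by decide)
  have : h .univ + h {v1, v4, v5, v8} ≤
      h {v1, v3, v4, v5, v8} + h {v1, v4, v5, v6, v7, v8, v9, v10, v9', v10'} :=
    H.submodular (by decide) (by decide)
  have : h {v1, v4, v5, v6, v7, v8, v9, v10, v9', v10'} + h {v1, v5, v6, v10} ≤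
      h {v1, v5, v6, v7, v10} + h {v1, v4, v5, v6, v9, v10, v9', v10'} :=
    H.submodular (by decide) (by decide)
  have : h {v1, v4, v5, v6, v7, v8, v9, v10, v8', v9', v10'} + h {v1, v4, v5, v6, v9, v9'} ≤
      h {v1, v4, v5, v6, v7, v9, v8', v9'} + h {v1, v4, v5, v6, v9, v10, v9', v10'} :=
    H.submodular (by decide) (by decide)
  have : h .univ + h {v1, v4, v5, v6, v7, v9, v8', v9'} ≤
      h {v1, v2, v3, v4, v5, v6, v7, v9, v8', v9'} + h {v1, v4, v5, v6, v7, v8, v9, v8', v9'} :=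
    H.submodular (by decide) (by decide)
  have : h .univ + h {v1, v4, v5, v6, v8, v10, v8', v10'} ≤
      h {v1, v3, v4, v5, v6, v8, v10, v8', v10'} +
        h {v1, v4, v5, v6, v7, v8, v9, v10, v8', v9', v10'} :=
    H.submodular (by decide) (by decide)
  linarith

lemma six_mul_univ_le (H : IsGuessingPolymatroid (toDigraph RcMinus) c h) :
    6 * h .univ ≤ 53 * c := by
  have := H.six_mul_univ_add_le
  have : h {v1, v3, v4, v5, v8} ≤
      h {v1, v3, v4, v5} + (1 : ℕ) * c :=
    H.le_add_card_mul _ {v8} (by decide)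
  have : h {v1, v5, v6, v7, v10} ≤
      h {v1, v5, v6, v7} + (1 : ℕ) * c :=
    H.le_add_card_mul _ {v10} (by decide)
  have : h {v1, v2, v4, v5, v6, v7, v8, v10, v8', v10'} ≤
      h {v1, v4, v5, v6, v8, v10, v8', v10'} + (1 : ℕ) * c :=
    H.le_add_card_mul _ {v2} (by decide)
  have : h {v1, v3, v4, v5, v6, v8, v10, v8', v10'} ≤
      h {v1, v5, v6, v10} + (4 : ℕ) * c :=
    H.le_add_card_mul _ {v3, v8, v8', v10'} (by decide)
  have : h {v1, v4, v5, v6, v7, v8, v9, v8', v9'} ≤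
      h {v1, v4, v5, v8} + (4 : ℕ) * c :=
    H.le_add_card_mul _ {v7, v9, v8', v9'} (by decide)
  have : h {v1, v2, v3, v4, v5, v6, v9, v8', v9'} ≤
      h {v1, v4, v5, v6, v9, v9'} + (2 : ℕ) * c :=
    H.le_add_card_mul _ {v2, v8'} (by decide)
  have : h {v1, v2, v3, v4, v5, v6, v7} ≤ (6 : ℕ) * c :=
    H.le_card_mul {v2, v3, v4, v5, v6, v7} (by decide)
  have : h {v1, v3, v4, v5, v8, v10, v8', v10'} ≤ (7 : ℕ) * c :=
    H.le_card_mul {v1, v3, v5, v8, v10, v8', v10'} (by decide)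
  have : h {v1, v4, v5, v6, v9, v10, v9', v10'} ≤ (7 : ℕ) * c :=
    H.le_card_mul {v1, v4, v6, v9, v10, v9', v10'} (by decide)
  have : h {v1, v5, v6, v7, v8, v9, v8', v9'} ≤ (7 : ℕ) * c :=
    H.le_card_mul {v1, v5, v7, v8, v9, v8', v9'} (by decide)
  push_cast at *
  linarith

end IsGuessingPolymatroid

lemma guessingNumber_rcMinus_le {s : ℕ} (hs : 2 ≤ s) :
    guessingNumber (toDigraph RcMinus) s ≤ 53 / 6 :=
  guessingNumber_le_of_polymatroid (fun _ _ H => by linarith [H.six_mul_univ_le]) hs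

lemma guessingNumber_rcPlus_le {s : ℕ} (hs : 2 ≤ s) : guessingNumber RcPlus s ≤ 9 :=
  guessingNumber_le_of_polymatroid (fun _ _ H => mod_cast
    H.le_card_mul {v1, v3, v4, v6, v7, v9, v10, v9', v10'} (by decide)) hs

end UpperBounds

section LowerBounds

open RcVertex

/-- The coefficients of each player's value in the four parity checks of a ternary code for
`R_c^+`. -/
def checkVector : RcVertex → Fin 4 → ZMod 3
  | .inl .v1 => ![0, 0, 0, 1]
  | .inl .v2 => ![1, 0, 0, 1]
  | .inl .v3 => ![0, 0, 1, 1]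
  | .inl .v4 => ![0, 1, 0, -1]
  | .inl .v5 => ![1, 0, 0, -1]
  | .inl .v6 => ![0, 0, 1, -1]
  | .inl .v7 => ![0, 1, 0, 1]
  | .inl .v8 => ![1, 0, -1, 0]
  | .inl .v9 => ![1, -1, 0, 0]
  | .inl .v10 => ![1, 0, -1, 0]
  | .inr ⟨.v8, _⟩ => ![1, -1, 0, 0]
  | .inr ⟨.v9, _⟩ => ![1, 0, 1, 0]
  | .inr _ => ![1, 1, 0, 0]

/-- The coefficients of the combination of parity checks in which the value of `v` occurs, but none
of the other values that player `v` does not see. -/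
def decodingVector : RcVertex → Fin 4 → ZMod 3
  | .inl .v1 => ![0, 0, 0, 1]
  | .inl .v2 => ![-1, -1, -1, -1]
  | .inl .v3 => ![-1, 1, -1, -1]
  | .inl .v4 => ![-1, -1, 1, 1]
  | .inl .v5 => ![-1, -1, -1, 1]
  | .inl .v6 => ![-1, 1, -1, 1]
  | .inl .v7 => ![-1, -1, 1, -1]
  | .inl .v8 => ![0, 0, -1, 0]
  | .inl .v9 => ![1, 0, -1, 0]
  | .inl .v10 => ![1, -1, 0, 0]
  | .inr ⟨.v8, _⟩ => ![0, -1, 0, 0]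
  | .inr ⟨.v9, _⟩ => ![0, 0, 1, 0]
  | .inr _ => ![0, 1, 0, 0]

lemma fits_rcPlus : Fits RcPlus decodingVector checkVector := by decide

lemma exists_isCode_rcPlus : ∃ W : Set (RcVertex → ZMod 3), IsCode RcPlus W ∧ 3 ^ 9 ≤ W.ncard := by
  have hcard : Fintype.card RcVertex - Fintype.card (Fin 4) = 9 := by decide
  simpa only [hcard, Nat.card_zmod] using fits_rcPlus.exists_isCode

/-- Thirteen triangles of `R_c^-`. Together with three copies of `R_c^+` mapped by `foldEight`, they
cover every vertex six times. -/
def triangle : Fin 13 → Fin 3 → RcVertex :=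
  ![![v1, v2, v3], ![v1, v2, v7], ![v1, v3, v4], ![v2, v3, v9], ![v4, v5, v10], ![v4, v5, v10],
    ![v5, v6, v9], ![v6, v7, v8], ![v6, v7, v8], ![v8, v9, v10], ![v8, v9', v10'],
    ![v8, v9', v10'], ![v8, v9', v10']]

lemma triangle_adj : ∀ i k l, k ≠ l → RcMinus.Adj (triangle i k) (triangle i l) := by
  decide

/-- The map sending `8` to its clone and fixing the other vertices. It takes the arc from `3` to `8`
of `R_c^+` to an edge of `R_c^-`, as the clone is joined to `3`. -/
def foldEight : RcVertex → RcVertex := Function.update id v8 v8'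

lemma foldEight_adj : ∀ u w, RcPlus.Adj u w → RcMinus.Adj (foldEight u) (foldEight w) := by decide

lemma card_fiber_foldEight_add_card_fiber_triangle (v : RcVertex) :
    3 * Fintype.card {u // foldEight u = v} + ∑ i, Fintype.card {k // triangle i k = v} = 6 := by
  decide +revert

lemma exists_isCode_rcMinus : ∃ W : Set (RcVertex → Fin 6 → ZMod 3),
    IsCode (toDigraph RcMinus) W ∧ 3 ^ 53 ≤ W.ncard := by
  obtain ⟨W₁, hW₁, hcard₁⟩ := exists_isCode_rcPlus
  obtain ⟨W₂, hW₂, hcard₂⟩ := exists_isCode_top (Fin 3) (ZMod 3)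
  let U : Fin 3 ⊕ Fin 13 → Type := Sum.elim (fun _ => RcVertex) fun _ => Fin 3
  let H : ∀ i, Digraph (U i) := Sum.rec (fun _ => RcPlus) fun _ => toDigraph ⊤
  let W : ∀ i, Set (U i → ZMod 3) := Sum.rec (fun _ => W₁) fun _ => W₂
  let f : ∀ i, U i → RcVertex := Sum.rec (fun _ => foldEight) triangle
  have : ∀ i, Finite (U i) :=
    Sum.rec (fun _ => inferInstanceAs (Finite RcVertex)) fun _ => inferInstanceAs (Finite (Fin 3))
  have hfiber (v : RcVertex) : ∑ i, Nat.card {u // f i u = v} = 6 := by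
    rw [Fintype.sum_sum_type, ← card_fiber_foldEight_add_card_fiber_triangle v]
    simp only [← Nat.card_eq_fintype_card, f, U, Sum.elim_inl, Sum.elim_inr, Finset.sum_const,
      Finset.card_univ, smul_eq_mul]
    rw [Nat.card_fin]
  obtain ⟨W', hW', hcard⟩ := exists_isCode_of_cover (G := toDigraph RcMinus) (H := H) (W := W)
    (Sum.rec (fun _ => hW₁) fun _ => hW₂) f (Sum.rec (fun _ => foldEight_adj) triangle_adj) hfiber
  refine ⟨W', hW', ?_⟩
  calc 3 ^ 53 = (3 ^ 9) ^ 3 * (3 ^ 2) ^ 13 := by norm_num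
    _ ≤ W₁.ncard ^ 3 * W₂.ncard ^ 13 := by
        gcongr
        simpa using hcard₂
    _ = W'.ncard := by
        rw [hcard, Fintype.prod_sum_type]
        simp [W, U]

end LowerBounds

section Limits

open Real

theorem hasAsymptoticGuessingNumber_rcPlus : HasAsymptoticGuessingNumber RcPlus 9 := by
  obtain ⟨W, hW, hcard⟩ := exists_isCode_rcPlus
  have hne : W.Nonempty := Set.nonempty_of_ncard_ne_zero (by omega)
  refine hW.hasAsymptoticGuessingNumber hne ?_ fun s => guessingNumber_rcPlus_le
  calc 9 * log (Nat.card (ZMod 3)) = log ((3 ^ 9 : ℕ) : ℝ) := by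
        rw [Nat.card_zmod, Nat.cast_pow, log_pow]
        norm_num
    _ ≤ log W.ncard := by gcongr

theorem hasAsymptoticGuessingNumber_rcMinus :
    HasAsymptoticGuessingNumber (toDigraph RcMinus) (53 / 6) := by
  obtain ⟨W, hW, hcard⟩ := exists_isCode_rcMinus
  have hne : W.Nonempty := Set.nonempty_of_ncard_ne_zero (by omega)
  refine hW.hasAsymptoticGuessingNumber hne ?_ fun s => guessingNumber_rcMinus_le
  calc 53 / 6 * log (Nat.card (Fin 6 → ZMod 3)) = log ((3 ^ 53 : ℕ) : ℝ) := by
        simp only [Nat.card_fun, Nat.card_fin, Nat.card_zmod, Nat.cast_pow, log_pow]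
        ring
    _ ≤ log W.ncard := by gcongr

end Limits

end GuessingGame

theorem mainTheorem3 :
    -- the two asymptotic guessing numbers
    GuessingGame.HasAsymptoticGuessingNumber
        (GuessingGame.toDigraph GuessingGame.RcMinus) (53 / 6) ∧
    GuessingGame.HasAsymptoticGuessingNumber GuessingGame.RcPlus 9 ∧
    -- adding one directed edge to an undirected graph can increase the asymptotic guessing number
    (∃ (V : Type) (_ : Fintype V) (G : SimpleGraph V) (u v : V) (x y : ℝ),
      u ≠ v ∧ ¬ G.Adj u v ∧
      GuessingGame.HasAsymptoticGuessingNumber (GuessingGame.toDigraph G) x ∧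
      GuessingGame.HasAsymptoticGuessingNumber
        (GuessingGame.addArc (GuessingGame.toDigraph G) u v) y ∧
      x < y) := by
  have hnadj : ¬ GuessingGame.RcMinus.Adj (.inl .v3) (.inl .v8) := by decide
  exact ⟨GuessingGame.hasAsymptoticGuessingNumber_rcMinus,
    GuessingGame.hasAsymptoticGuessingNumber_rcPlus, GuessingGame.RcVertex, inferInstance,
    GuessingGame.RcMinus, .inl .v3, .inl .v8, 53 / 6, 9, by decide, hnadj,
    GuessingGame.hasAsymptoticGuessingNumber_rcMinus,
    GuessingGame.hasAsymptoticGuessingNumber_rcPlus, by norm_num⟩
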